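/- Let $d\ge 1$, let $U\in\mathbb R^{n\times d}$ satisfy $U^TU=I$ (so $n\ge d$), and let $\sigma_c>0$, $\sigma_z\ge 0$, $\varepsilon\ge 0$ with $\varepsilon^2<\sigma_c^2$. The signal is $x=Uc$ with $c\sim\mathcal N(0,\frac{\sigma_c^2}{d}I)$ and the measurement is $y=x+z$ with $z\sim\mathcal N(0,\frac{\sigma_z^2}{n}I)$ independent of $c$. For a symmetric matrix $H\in\mathbb R^{n\times n}$, identified with the estimator $f(y)=Hy$, put $$R_\varepsilon(H)=\mathbb E\Big[\max_{\|e\|_2\le\varepsilon}\|H(y+e)-x\|_2^2\Big],\qquad J_{\sigma_w}(H)=\mathbb E\big[\|H(y+w)-x\|_2^2\big],$$ where $w\sim\mathcal N(0,\sigma_w^2I)$ is independent of $(c,z)$. Choose the jittering noise level $$\sigma_w=\sigma_w(\varepsilon)=\sqrt{\frac{\varepsilon^2\sigma_z^2\frac dn+\sigma_z\sqrt{\frac dn}\,\sigma_c\,\varepsilon\sqrt{\sigma_c^2-\varepsilon^2+\sigma_z^2\frac dn}}{d(\sigma_c^2-\varepsilon^2)}}.$$ Then: 1. The matrix $H_j=\alpha_j\,UU^T$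 with $\alpha_j=\dfrac{\sigma_c^2}{\sigma_c^2+\sigma_z^2\frac dn+\sigma_w^2d}$ minimizes $J_{\sigma_w}$ among all symmetric matrices, and it is the only minimizer if $\sigma_z>0$. 2. $\alpha_j=\dfrac{\sigma_c^2-\dfrac{\varepsilon\sigma_c\sigma_z\sqrt{d/n}}{\sqrt{\sigma_c^2+\sigma_z^2\frac dn-\varepsilon^2}}}{\sigma_c^2+\sigma_z^2\frac dn}$, the shrinkage factor of the worst-case optimal estimator. 3. For $d\to\infty$, $H_j$ also minimizes the worst-case risk $R_\varepsilon$ among all symmetric matrices, in the following sense: for every $\delta>0$ there is a $D$, depending only on $\delta$, such that whenever $d\ge D$, $$R_\varepsilon(H_j)\le(1+\delta)\,R_\varepsilon(H)\qquad\text{for every symmetric } H\in\mathbb R^{n\times n}.$$ -/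

import Mathlib

open MeasureTheory ProbabilityTheory
open scoped ENNReal

namespace RobustDenoising

/-- The centred Gaussian law `N(0, v I)` on `ℝ^k`. -/
noncomputable def isoGaussian (k : ℕ) (v : ℝ) : Measure (EuclideanSpace ℝ (Fin k)) :=
  multivariateGaussian 0 (v • (1 : Matrix (Fin k) (Fin k) ℝ))

/-- The joint law of the independent pair `(c, z)` of the latent code `c ∼ N(0, σc² / d I)` in `ℝ^d`
and the measurement noise `z ∼ N(0, σz² / n I)` in `ℝ^n`. -/
noncomputable def latentNoiseLaw (d n : ℕ) (σc σz : ℝ) :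
    Measure (EuclideanSpace ℝ (Fin d) × EuclideanSpace ℝ (Fin n)) :=
  (isoGaussian d (σc ^ 2 / d)).prod (isoGaussian n (σz ^ 2 / n))

/-- The robust risk `E [max_{‖e‖ ≤ ε} ‖f (y + e) - x‖²]` of an estimator `f` of the signal `x = U c`
from the measurement `y = x + z`, as an expectation with values in `[0, ∞]`. -/
noncomputable def robustRisk {d n : ℕ} (U : Matrix (Fin n) (Fin d) ℝ) (σc σz ε : ℝ)
    (f : EuclideanSpace ℝ (Fin n) → EuclideanSpace ℝ (Fin n)) : ℝ≥0∞ :=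
  ∫⁻ p, ⨆ e ∈ Metric.closedBall (0 : EuclideanSpace ℝ (Fin n)) ε,
    ‖f (U.toEuclideanLin p.1 + p.2 + e) - U.toEuclideanLin p.1‖ₑ ^ 2
    ∂(latentNoiseLaw d n σc σz)

/-- The jittering risk `E [‖f (y + w) - x‖²]` of an estimator `f` of the signal `x = U c`
from the measurement `y = x + z`, with independent jittering noise `w ∼ N(0, σw² I)`. -/
noncomputable def jitteringRisk {d n : ℕ} (U : Matrix (Fin n) (Fin d) ℝ) (σc σz σw : ℝ)
    (f : EuclideanSpace ℝ (Fin n) → EuclideanSpace ℝ (Fin n)) : ℝ≥0∞ :=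
  ∫⁻ p, ‖f (U.toEuclideanLin p.1.1 + p.1.2 + p.2) - U.toEuclideanLin p.1.1‖ₑ ^ 2
    ∂((latentNoiseLaw d n σc σz).prod (isoGaussian n (σw ^ 2)))

/-- The linear estimator `f(y) = H y`. -/
noncomputable def linearEstimator {n : ℕ} (H : Matrix (Fin n) (Fin n) ℝ) :
    EuclideanSpace ℝ (Fin n) → EuclideanSpace ℝ (Fin n) :=
  fun y => H.toEuclideanLin y

/-- `H` is symmetric, and the estimator `f(y) = H y` minimizes the jittering risk among all
estimators given by symmetric matrices. -/
def IsJitteringMinimizer {d n : ℕ} (U : Matrix (Fin n) (Fin d) ℝ) (σc σz σw : ℝ)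
    (H : Matrix (Fin n) (Fin n) ℝ) : Prop :=
  H.IsSymm ∧ IsMinOn (fun H' : Matrix (Fin n) (Fin n) ℝ =>
    jitteringRisk U σc σz σw (linearEstimator H')) {H' | H'.IsSymm} H

/-- The jittering noise level `σ_w(ε)`. -/
noncomputable def jitterLevel (d n : ℕ) (σc σz ε : ℝ) : ℝ :=
  √((ε ^ 2 * σz ^ 2 * (d / n) +
      σz * √(d / n) * σc * ε * √(σc ^ 2 - ε ^ 2 + σz ^ 2 * (d / n))) /
    (d * (σc ^ 2 - ε ^ 2)))

/-- The shrinkage factor of the jittering estimator. -/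
noncomputable def jitterShrinkage (d n : ℕ) (σc σz σw : ℝ) : ℝ :=
  σc ^ 2 / (σc ^ 2 + σz ^ 2 * (d / n) + σw ^ 2 * d)

/-- The shrinkage factor of the worst-case optimal estimator in the regime `ε² < σc²`. -/
noncomputable def robustShrinkage (d n : ℕ) (σc σz ε : ℝ) : ℝ :=
  (σc ^ 2 - ε * σc * σz * √(d / n) / √(σc ^ 2 + σz ^ 2 * (d / n) - ε ^ 2)) /
    (σc ^ 2 + σz ^ 2 * (d / n))

end RobustDenoising

/-!
The robust risk is convex in `H`, does not increase when `H` is multiplied on the left by the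
projection `U Uᵀ`, and is invariant under conjugation by the reflection `2 U Uᵀ - 1` and by the
orthogonal transformations of the range of `U`. Averaging over the reflection, the sign changes and
the permutations of coordinates therefore replaces any `H` by a multiple `α U Uᵀ` without increasing
its risk. The risk of `α U Uᵀ` is `E (‖g‖ + |α| ε)²` for an isotropic Gaussian vector `g` in `ℝ^d`,
and `(1 - 1 / d) √(E ‖g‖²) ≤ E ‖g‖ ≤ √(E ‖g‖²)`, so up to a factor `1 - 1 / d` which depends on
nothing else it is `(√(E ‖g‖²) + |α| ε)²`; Cauchy–Schwarz against a suitable unit vector minimizes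
this over `α`. The jittering risk is a quadratic function of `H` in the Frobenius norm, minimized by
completing the square.
-/

namespace RobustDenoising

open Module
open scoped RealInnerProductSpace Matrix.Norms.Frobenius

section StandardGaussian

lemma integral_sq_gaussianReal : ∫ x, x ^ 2 ∂(gaussianReal 0 1) = 1 := by
  have h := variance_fun_id_gaussianReal (μ := 0) (v := 1)
  rw [variance_of_integral_eq_zero (by fun_prop) (by simp)] at h
  simpa using h

lemma deriv_polynomial_mul_exp_sq_div_two (p : Polynomial ℝ) :
    deriv (fun t => p.eval t * Real.exp (t ^ 2 / 2)) =
      fun t => (p.derivative + Polynomial.X * p).eval t * Real.exp (t ^ 2 / 2) := by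
  ext t
  have hexp : HasDerivAt (fun t : ℝ => Real.exp (t ^ 2 / 2)) (Real.exp (t ^ 2 / 2) * t) t := by
    simpa using ((hasDerivAt_pow 2 t).div_const 2).exp
  refine ((p.hasDerivAt t).mul hexp).deriv.trans ?_
  simp only [Polynomial.eval_add, Polynomial.eval_mul, Polynomial.eval_X]
  ring

lemma integral_pow_four_gaussianReal : ∫ x, x ^ 4 ∂(gaussianReal 0 1) = 3 := by
  have hmoment := iteratedDeriv_mgf_zero (X := id) (μ := gaussianReal 0 1)
    (by simp [integrableExpSet_id_gaussianReal]) 4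
  have hmgf : mgf id (gaussianReal 0 1) =
      fun t => (1 : Polynomial ℝ).eval t * Real.exp (t ^ 2 / 2) := by
    simp [mgf_id_gaussianReal]
  rw [hmgf] at hmoment
  simp only [iteratedDeriv_succ', iteratedDeriv_zero, deriv_polynomial_mul_exp_sq_div_two]
    at hmoment
  norm_num at hmoment
  exact hmoment.symm

lemma memLp_sq_gaussianReal : MemLp (fun x : ℝ => x ^ 2) 2 (gaussianReal 0 1) := by
  rw [memLp_two_iff_integrable_sq (by fun_prop)]
  have h := (memLp_id_gaussianReal (μ := 0) (v := 1) 4).integrable_norm_pow (by norm_num)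
  simpa [← pow_mul, Even.pow_abs (show Even 4 by decide)] using h

lemma variance_sq_gaussianReal : Var[fun x => x ^ 2; gaussianReal 0 1] = 2 := by
  rw [variance_eq_sub memLp_sq_gaussianReal, integral_sq_gaussianReal]
  simp only [Pi.pow_apply, ← pow_mul]
  norm_num [integral_pow_four_gaussianReal]

variable {E : Type*} [NormedAddCommGroup E] [InnerProductSpace ℝ E]

lemma norm_sq_sum_smul_orthonormalBasis {ι : Type*} [Fintype ι] (b : OrthonormalBasis ι ℝ E)
    (x : ι → ℝ) : ‖∑ i, x i • b i‖ ^ 2 = ∑ i, x i ^ 2 := by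
  rw [← b.sum_sq_norm_inner_right]
  simp [b.orthonormal.inner_right_fintype]

variable [FiniteDimensional ℝ E] [MeasurableSpace E] [BorelSpace E]

lemma integrable_norm_pow_stdGaussian (p : ℕ) :
    Integrable (fun x : E => ‖x‖ ^ p) (stdGaussian E) := by
  rcases eq_or_ne p 0 with rfl | hp
  · simp
  · exact (IsGaussian.memLp_id (stdGaussian E) p (by simp)).integrable_norm_pow hp

variable (E) in
lemma integral_norm_sq_stdGaussian : ∫ x, ‖x‖ ^ 2 ∂(stdGaussian E) = finrank ℝ E := by
  have hnorm : StronglyMeasurable (fun x : E => ‖x‖ ^ 2) := by fun_prop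
  rw [stdGaussian, integral_map (Measurable.aemeasurable (by fun_prop))
    hnorm.aestronglyMeasurable]
  simp_rw [norm_sq_sum_smul_orthonormalBasis]
  rw [integral_finsetSum]
  · have hcoord (i : Fin (finrank ℝ E)) :
        ∫ x, x i ^ 2 ∂(Measure.pi fun _ : Fin (finrank ℝ E) => gaussianReal 0 1) = 1 :=
      (integral_comp_eval (μ := fun _ => gaussianReal 0 1) (f := fun x : ℝ => x ^ 2)
        (by fun_prop)).trans integral_sq_gaussianReal
    simp [hcoord]
  · exact fun i _ => integrable_comp_eval (μ := fun _ => gaussianReal 0 1)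
      (f := fun x : ℝ => x ^ 2) (memLp_sq_gaussianReal.integrable one_le_two)

variable (E) in
lemma variance_norm_sq_stdGaussian :
    Var[fun x : E => ‖x‖ ^ 2; stdGaussian E] = 2 * finrank ℝ E := by
  rw [stdGaussian, variance_map (by fun_prop) (Measurable.aemeasurable (by fun_prop))]
  have hsum : (fun x : E => ‖x‖ ^ 2) ∘ (fun x => ∑ i, x i • stdOrthonormalBasis ℝ E i) =
      ∑ i, fun x : Fin (finrank ℝ E) → ℝ => x i ^ 2 := by
    ext x
    simp [norm_sq_sum_smul_orthonormalBasis]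
  rw [hsum, variance_sum_pi fun _ => memLp_sq_gaussianReal]
  simp [variance_sq_gaussianReal, mul_comm]

variable (E) in
lemma integral_norm_pow_four_stdGaussian :
    ∫ x, ‖x‖ ^ 4 ∂(stdGaussian E) = (finrank ℝ E : ℝ) ^ 2 + 2 * finrank ℝ E := by
  have hmem : MemLp (fun x : E => ‖x‖ ^ 2) 2 (stdGaussian E) := by
    rw [memLp_two_iff_integrable_sq (by fun_prop)]
    simpa only [← pow_mul] using integrable_norm_pow_stdGaussian 4
  have hvar := variance_norm_sq_stdGaussian E
  rw [variance_eq_sub hmem, integral_norm_sq_stdGaussian] at hvar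
  simp only [Pi.pow_apply, ← pow_mul] at hvar
  norm_num at hvar
  linarith

-- The even moments of `‖x‖` are explicit, so `‖x‖` is bounded below by an even quartic, the one
-- through `0` tangent to the identity at `s`.
lemma quartic_le_self {s t : ℝ} (hs : 0 < s) (ht : 0 ≤ t) :
    3 / (2 * s) * t ^ 2 - 1 / (2 * s ^ 3) * t ^ 4 ≤ t := by
  have hfactor : t - (3 / (2 * s) * t ^ 2 - 1 / (2 * s ^ 3) * t ^ 4) =
      t * ((t - s) ^ 2 * (t + 2 * s)) / (2 * s ^ 3) := by
    field_simp
    ring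
  have hnonneg : 0 ≤ t * ((t - s) ^ 2 * (t + 2 * s)) / (2 * s ^ 3) := by positivity
  linarith

variable (E) in
lemma le_integral_norm_stdGaussian [Nontrivial E] :
    (1 - 1 / finrank ℝ E) * √(finrank ℝ E) ≤ ∫ x, ‖x‖ ∂(stdGaussian E) := by
  have hs : 0 < √(finrank ℝ E : ℝ) := Real.sqrt_pos.2 (by exact_mod_cast finrank_pos)
  have hsq : (finrank ℝ E : ℝ) = √(finrank ℝ E : ℝ) ^ 2 := (Real.sq_sqrt (by positivity)).symm
  have h2 := (integrable_norm_pow_stdGaussian (E := E) 2).const_mul (3 / (2 * √(finrank ℝ E)))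
  have h4 := (integrable_norm_pow_stdGaussian (E := E) 4).const_mul (1 / (2 * √(finrank ℝ E) ^ 3))
  calc (1 - 1 / finrank ℝ E) * √(finrank ℝ E)
      = 3 / (2 * √(finrank ℝ E)) * finrank ℝ E -
          1 / (2 * √(finrank ℝ E) ^ 3) * ((finrank ℝ E : ℝ) ^ 2 + 2 * finrank ℝ E) := by
        generalize √(finrank ℝ E : ℝ) = s at hs hsq
        rw [hsq]
        field_simp
        ring
    _ = ∫ x, (3 / (2 * √(finrank ℝ E)) * ‖x‖ ^ 2 - 1 / (2 * √(finrank ℝ E) ^ 3) * ‖x‖ ^ 4)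
          ∂(stdGaussian E) := by
        rw [integral_sub h2 h4, integral_const_mul, integral_const_mul,
          integral_norm_sq_stdGaussian, integral_norm_pow_four_stdGaussian]
    _ ≤ ∫ x, ‖x‖ ∂(stdGaussian E) :=
        integral_mono (h2.sub h4) (by simpa using integrable_norm_pow_stdGaussian (E := E) 1)
          fun x => quartic_le_self hs (norm_nonneg x)

end StandardGaussian

section EuclideanLin

variable {m n : ℕ}

lemma inner_toEuclideanLin (M : Matrix (Fin m) (Fin n) ℝ) (x : EuclideanSpace ℝ (Fin n))
    (y : EuclideanSpace ℝ (Fin m)) :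
    ⟪M.toEuclideanLin x, y⟫ = ⟪x, M.transpose.toEuclideanLin y⟫ := by
  rw [← Matrix.conjTranspose_eq_transpose_of_trivial,
    Matrix.toEuclideanLin_conjTranspose_eq_adjoint, LinearMap.adjoint_inner_right]

lemma toEuclideanLin_mul_apply {k : ℕ} (M : Matrix (Fin m) (Fin n) ℝ) (N : Matrix (Fin n) (Fin k) ℝ)
    (x : EuclideanSpace ℝ (Fin k)) :
    (M * N).toEuclideanLin x = M.toEuclideanLin (N.toEuclideanLin x) := by
  simp [Matrix.toLpLin_apply]

lemma toEuclideanLin_sub_one_mul_apply (H : Matrix (Fin m) (Fin m) ℝ)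
    (U : Matrix (Fin m) (Fin n) ℝ) (x : EuclideanSpace ℝ (Fin n)) :
    ((H - 1) * U).toEuclideanLin x =
      H.toEuclideanLin (U.toEuclideanLin x) - U.toEuclideanLin x := by
  simp [Matrix.toLpLin_apply, Matrix.sub_mul]

lemma norm_toEuclideanLin_of_transpose_mul_self {U : Matrix (Fin m) (Fin n) ℝ}
    (hU : U.transpose * U = 1) (x : EuclideanSpace ℝ (Fin n)) : ‖U.toEuclideanLin x‖ = ‖x‖ := by
  rw [← sq_eq_sq₀ (norm_nonneg _) (norm_nonneg _), ← real_inner_self_eq_norm_sq,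
    inner_toEuclideanLin, ← toEuclideanLin_mul_apply, hU]
  simp

lemma frobenius_norm_sq (M : Matrix (Fin m) (Fin n) ℝ) : ‖M‖ ^ 2 = ∑ i, ∑ j, M i j ^ 2 := by
  rw [Matrix.frobenius_norm_def, ← Real.sqrt_eq_rpow, Real.sq_sqrt (by positivity)]
  simp

lemma frobenius_norm_sq_eq_trace (M : Matrix (Fin m) (Fin n) ℝ) :
    ‖M‖ ^ 2 = (M * M.transpose).trace := by
  rw [frobenius_norm_sq]
  simp [Matrix.trace, Matrix.mul_apply, sq]

lemma frobenius_norm_add_sq (M N : Matrix (Fin m) (Fin n) ℝ) :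
    ‖M + N‖ ^ 2 = ‖M‖ ^ 2 + 2 * (N * M.transpose).trace + ‖N‖ ^ 2 := by
  have hsymm : (M * N.transpose).trace = (N * M.transpose).trace := by
    rw [← Matrix.trace_transpose, Matrix.transpose_mul, Matrix.transpose_transpose]
  simp only [frobenius_norm_sq_eq_trace, Matrix.transpose_add, Matrix.add_mul, Matrix.mul_add,
    Matrix.trace_add, hsymm]
  ring

end EuclideanLin

section IsotropicGaussian

variable {k m : ℕ} {v w : ℝ}

instance isGaussian_isoGaussian (k : ℕ) (v : ℝ) : IsGaussian (isoGaussian k v) := by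
  unfold isoGaussian
  infer_instance

lemma charFun_isoGaussian (hv : 0 ≤ v) (t : EuclideanSpace ℝ (Fin k)) :
    charFun (isoGaussian k v) t = Complex.exp (-(v * ‖t‖ ^ 2 / 2 : ℝ)) := by
  rw [isoGaussian, charFun_multivariateGaussian (Matrix.PosSemidef.one.smul hv)]
  simp only [inner_zero_right, EuclideanSpace.real_norm_sq_eq, Matrix.smul_mulVec,
    Matrix.one_mulVec, dotProduct]
  push_cast
  congr 1
  simp [Finset.mul_sum, sq, Finset.sum_div, mul_left_comm]

lemma isoGaussian_eq_map_stdGaussian (hv : 0 ≤ v) :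
    isoGaussian k v = (stdGaussian (EuclideanSpace ℝ (Fin k))).map (fun x => √v • x) := by
  have := Measure.isProbabilityMeasure_map (μ := stdGaussian (EuclideanSpace ℝ (Fin k)))
    (f := fun x => √v • x) (by fun_prop)
  refine Measure.ext_of_charFun (funext fun t => ?_)
  rw [charFun_isoGaussian hv, charFun_map_smul, charFun_stdGaussian, norm_smul]
  congr 1
  simp [mul_pow, ← Complex.ofReal_pow, hv, neg_div]

lemma measurePreserving_toEuclideanLin_isoGaussian (hv : 0 ≤ v) {M : Matrix (Fin m) (Fin k) ℝ}
    (hM : M * M.transpose = 1) :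
    MeasurePreserving (fun x => M.toEuclideanLin x) (isoGaussian k v) (isoGaussian m v) := by
  have hmeas : Measurable fun x => M.toEuclideanLin x :=
    M.toEuclideanLin.continuous_of_finiteDimensional.measurable
  refine ⟨hmeas, ?_⟩
  have := Measure.isProbabilityMeasure_map (μ := isoGaussian k v) hmeas.aemeasurable
  refine Measure.ext_of_charFun (funext fun t => ?_)
  have hnorm : ‖M.transpose.toEuclideanLin t‖ = ‖t‖ :=
    norm_toEuclideanLin_of_transpose_mul_self (by simpa using hM) t
  rw [charFun_isoGaussian hv, ← hnorm, ← charFun_isoGaussian hv, charFun_apply, charFun_apply,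
    integral_map hmeas.aemeasurable (by fun_prop)]
  simp_rw [inner_toEuclideanLin]

lemma measurePreserving_smul_add_smul_isoGaussian (hv : 0 ≤ v) (hw : 0 ≤ w) (p q : ℝ) :
    MeasurePreserving
      (fun x : EuclideanSpace ℝ (Fin k) × EuclideanSpace ℝ (Fin k) => p • x.1 + q • x.2)
      ((isoGaussian k v).prod (isoGaussian k w)) (isoGaussian k (p ^ 2 * v + q ^ 2 * w)) := by
  refine ⟨by fun_prop, ?_⟩
  have := Measure.isProbabilityMeasure_map (μ := (isoGaussian k v).prod (isoGaussian k w))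
    (f := fun x => p • x.1 + q • x.2) (by fun_prop)
  refine Measure.ext_of_charFun (funext fun t => ?_)
  have hp := charFun_isoGaussian hv (p • t)
  have hq := charFun_isoGaussian hw (q • t)
  simp only [charFun_apply, inner_smul_right] at hp hq
  rw [charFun_isoGaussian (by positivity), charFun_apply, integral_map (by fun_prop) (by fun_prop)]
  simp only [inner_add_left, inner_smul_left, conj_trivial, Complex.ofReal_add, add_mul,
    Complex.exp_add]
  rw [integral_prod_mul (fun x => Complex.exp ((p * ⟪x, t⟫ : ℝ) * Complex.I))
    (fun x => Complex.exp ((q * ⟪x, t⟫ : ℝ) * Complex.I)), hp, hq, ← Complex.exp_add]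
  congr 1
  simp only [norm_smul, mul_pow, Real.norm_eq_abs, sq_abs]
  push_cast
  ring

lemma integral_norm_sq_isoGaussian (hv : 0 ≤ v) : ∫ x, ‖x‖ ^ 2 ∂(isoGaussian k v) = v * k := by
  rw [isoGaussian_eq_map_stdGaussian hv, integral_map (by fun_prop) (by fun_prop)]
  simp_rw [norm_smul, mul_pow]
  rw [integral_const_mul, integral_norm_sq_stdGaussian]
  simp [hv]

lemma memLp_norm_isoGaussian (k : ℕ) (v : ℝ) : MemLp (fun x => ‖x‖) 2 (isoGaussian k v) :=
  (IsGaussian.memLp_two_id (μ := isoGaussian k v)).norm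

lemma integral_norm_isoGaussian_le (hv : 0 ≤ v) : ∫ x, ‖x‖ ∂(isoGaussian k v) ≤ √(v * k) := by
  have hvar := variance_nonneg (fun x => ‖x‖) (isoGaussian k v)
  rw [variance_eq_sub (memLp_norm_isoGaussian k v)] at hvar
  simp only [Pi.pow_apply, integral_norm_sq_isoGaussian hv] at hvar
  exact Real.le_sqrt_of_sq_le (by linarith)

lemma le_integral_norm_isoGaussian (hk : 0 < k) (hv : 0 ≤ v) :
    (1 - 1 / k) * √(v * k) ≤ ∫ x, ‖x‖ ∂(isoGaussian k v) := by
  have : Nonempty (Fin k) := ⟨⟨0, hk⟩⟩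
  have hstd := le_integral_norm_stdGaussian (EuclideanSpace ℝ (Fin k))
  rw [finrank_euclideanSpace_fin] at hstd
  rw [isoGaussian_eq_map_stdGaussian hv, integral_map (by fun_prop) (by fun_prop)]
  simp_rw [norm_smul]
  rw [integral_const_mul, Real.sqrt_mul hv, Real.norm_of_nonneg (Real.sqrt_nonneg _),
    mul_left_comm]
  gcongr

lemma integrable_norm_add_const_sq_isoGaussian (k : ℕ) (v t : ℝ) :
    Integrable (fun x => (‖x‖ + t) ^ 2) (isoGaussian k v) :=
  ((memLp_norm_isoGaussian k v).add (memLp_const t)).integrable_sq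

lemma integral_norm_add_const_sq_isoGaussian (hv : 0 ≤ v) (t : ℝ) :
    ∫ x, (‖x‖ + t) ^ 2 ∂(isoGaussian k v) =
      √(v * k) ^ 2 + 2 * t * ∫ x, ‖x‖ ∂(isoGaussian k v) + t ^ 2 := by
  have h1 := ((memLp_norm_isoGaussian k v).integrable one_le_two).const_mul (2 * t)
  have h2 := (memLp_norm_isoGaussian k v).integrable_sq
  have hexpand (x : EuclideanSpace ℝ (Fin k)) :
      (‖x‖ + t) ^ 2 = ‖x‖ ^ 2 + 2 * t * ‖x‖ + t ^ 2 := by ring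
  simp_rw [hexpand]
  rw [integral_add (by exact h2.add h1) (integrable_const _), integral_add h2 h1,
    integral_const_mul, integral_norm_sq_isoGaussian hv, Real.sq_sqrt (by positivity)]
  simp

lemma integral_norm_add_const_sq_isoGaussian_le (hv : 0 ≤ v) {t : ℝ} (ht : 0 ≤ t) :
    ∫ x, (‖x‖ + t) ^ 2 ∂(isoGaussian k v) ≤ (√(v * k) + t) ^ 2 := by
  rw [integral_norm_add_const_sq_isoGaussian hv]
  have hnorm := mul_le_mul_of_nonneg_left (integral_norm_isoGaussian_le (k := k) hv) ht
  linarith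

lemma le_integral_norm_add_const_sq_isoGaussian (hk : 0 < k) (hv : 0 ≤ v) {t : ℝ} (ht : 0 ≤ t) :
    (1 - 1 / k) * (√(v * k) + t) ^ 2 ≤ ∫ x, (‖x‖ + t) ^ 2 ∂(isoGaussian k v) := by
  rw [integral_norm_add_const_sq_isoGaussian hv]
  have hnorm := mul_le_mul_of_nonneg_left (le_integral_norm_isoGaussian hk hv) ht
  have hsq : 0 ≤ 1 / k * (√(v * k) ^ 2 + t ^ 2) := by positivity
  linarith

lemma memLp_toEuclideanLin_isoGaussian (v : ℝ) (M : Matrix (Fin m) (Fin k) ℝ) :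
    MemLp (fun x => M.toEuclideanLin x) 2 (isoGaussian k v) :=
  M.toEuclideanLin.toContinuousLinearMap.comp_memLp'
    (IsGaussian.memLp_two_id (μ := isoGaussian k v))

lemma integral_toEuclideanLin_isoGaussian (v : ℝ) (M : Matrix (Fin m) (Fin k) ℝ) :
    ∫ x, M.toEuclideanLin x ∂(isoGaussian k v) = 0 := by
  refine (M.toEuclideanLin.toContinuousLinearMap.integral_comp_comm
    (IsGaussian.integrable_id (μ := isoGaussian k v))).trans ?_
  simp [isoGaussian]

lemma integral_inner_sq_isoGaussian (hv : 0 ≤ v) (a : EuclideanSpace ℝ (Fin k)) :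
    ∫ x, ⟪a, x⟫ ^ 2 ∂(isoGaussian k v) = v * ‖a‖ ^ 2 := by
  have hmean : ∫ x, ⟪a, x⟫ ∂(isoGaussian k v) = 0 := by
    rw [integral_inner (f := fun x => x) IsGaussian.integrable_id]
    simp [isoGaussian]
  have hvar := covarianceBilin_multivariateGaussian (μ := 0)
    (Matrix.PosSemidef.one.smul hv : (v • (1 : Matrix (Fin k) (Fin k) ℝ)).PosSemidef) a a
  rw [covarianceBilin_self IsGaussian.memLp_two_id, ← isoGaussian,
    variance_of_integral_eq_zero (by fun_prop) hmean] at hvar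
  rw [hvar, EuclideanSpace.real_norm_sq_eq]
  simp [Matrix.smul_mulVec, dotProduct, sq, Finset.mul_sum, mul_left_comm]

lemma integral_norm_sq_toEuclideanLin_isoGaussian (hv : 0 ≤ v) (M : Matrix (Fin m) (Fin k) ℝ) :
    ∫ x, ‖M.toEuclideanLin x‖ ^ 2 ∂(isoGaussian k v) = v * ‖M‖ ^ 2 := by
  have hrows (x : EuclideanSpace ℝ (Fin k)) :
      ‖M.toEuclideanLin x‖ ^ 2 = ∑ i, ⟪WithLp.toLp 2 (M i), x⟫ ^ 2 := by
    rw [EuclideanSpace.real_norm_sq_eq]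
    simp [Matrix.toLpLin_apply, Matrix.mulVec, dotProduct, PiLp.inner_apply, mul_comm]
  simp_rw [hrows]
  rw [integral_finsetSum]
  · simp_rw [integral_inner_sq_isoGaussian hv, EuclideanSpace.real_norm_sq_eq, ← Finset.mul_sum,
      frobenius_norm_sq]
  · exact fun i _ => ((IsGaussian.memLp_two_id (μ := isoGaussian k v)).const_inner
      (WithLp.toLp 2 (M i))).integrable_sq

end IsotropicGaussian

section JitteringRisk

variable {d n : ℕ}

instance isProbabilityMeasure_latentNoiseLaw (d n : ℕ) (σc σz : ℝ) :
    IsProbabilityMeasure (latentNoiseLaw d n σc σz) := by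
  unfold latentNoiseLaw
  infer_instance

lemma integral_norm_add_sq_of_integral_eq_zero {Ω F : Type*} [MeasurableSpace Ω]
    [NormedAddCommGroup F] [InnerProductSpace ℝ F] [CompleteSpace F]
    {ν : Measure Ω} [IsProbabilityMeasure ν] {g : Ω → F} (hg : MemLp g 2 ν)
    (hmean : ∫ b, g b ∂ν = 0) (a : F) :
    ∫ b, ‖a + g b‖ ^ 2 ∂ν = ‖a‖ ^ 2 + ∫ b, ‖g b‖ ^ 2 ∂ν := by
  have hint := hg.integrable one_le_two
  have hcross := (hint.const_inner (𝕜 := ℝ) a).const_mul 2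
  simp_rw [norm_add_sq_real]
  rw [integral_add (by exact (integrable_const _).add hcross) hg.norm.integrable_sq,
    integral_add (integrable_const _) hcross, integral_const_mul, integral_inner hint, hmean]
  simp

lemma integral_prod_norm_add_sq {Ω₁ Ω₂ F : Type*} [MeasurableSpace Ω₁] [MeasurableSpace Ω₂]
    [NormedAddCommGroup F] [InnerProductSpace ℝ F] [CompleteSpace F]
    {μ : Measure Ω₁} {ν : Measure Ω₂} [IsProbabilityMeasure μ] [IsProbabilityMeasure ν]
    {f : Ω₁ → F} {g : Ω₂ → F} (hf : MemLp f 2 μ) (hg : MemLp g 2 ν) (hmean : ∫ b, g b ∂ν = 0) :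
    ∫ p, ‖f p.1 + g p.2‖ ^ 2 ∂(μ.prod ν) = ∫ a, ‖f a‖ ^ 2 ∂μ + ∫ b, ‖g b‖ ^ 2 ∂ν := by
  rw [integral_prod _ (by exact ((hf.comp_fst ν).add (hg.comp_snd μ)).norm.integrable_sq)]
  simp_rw [integral_norm_add_sq_of_integral_eq_zero hg hmean]
  rw [integral_add hf.norm.integrable_sq (integrable_const _)]
  simp

lemma linearEstimator_sub_eq (U : Matrix (Fin n) (Fin d) ℝ) (H : Matrix (Fin n) (Fin n) ℝ)
    (c : EuclideanSpace ℝ (Fin d)) (z : EuclideanSpace ℝ (Fin n)) :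
    linearEstimator H (U.toEuclideanLin c + z) - U.toEuclideanLin c =
      ((H - 1) * U).toEuclideanLin c + H.toEuclideanLin z := by
  rw [linearEstimator, map_add, toEuclideanLin_sub_one_mul_apply]
  abel

lemma jitteringRisk_linearEstimator (U : Matrix (Fin n) (Fin d) ℝ) (σc σz σw : ℝ)
    (H : Matrix (Fin n) (Fin n) ℝ) :
    jitteringRisk U σc σz σw (linearEstimator H) =
      ENNReal.ofReal (σc ^ 2 / d * ‖(H - 1) * U‖ ^ 2 + (σz ^ 2 / n + σw ^ 2) * ‖H‖ ^ 2) := by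
  have hc := memLp_toEuclideanLin_isoGaussian (σc ^ 2 / d) ((H - 1) * U)
  have hz := memLp_toEuclideanLin_isoGaussian (σz ^ 2 / n) H
  have hw := memLp_toEuclideanLin_isoGaussian (σw ^ 2) H
  have hcz : MemLp (fun p => ((H - 1) * U).toEuclideanLin p.1 + H.toEuclideanLin p.2) 2
      (latentNoiseLaw d n σc σz) := (hc.comp_fst _).add (hz.comp_snd _)
  have herror (p : (EuclideanSpace ℝ (Fin d) × EuclideanSpace ℝ (Fin n)) ×
      EuclideanSpace ℝ (Fin n)) :
      ‖linearEstimator H (U.toEuclideanLin p.1.1 + p.1.2 + p.2) - U.toEuclideanLin p.1.1‖ₑ ^ 2 =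
        ENNReal.ofReal (‖((H - 1) * U).toEuclideanLin p.1.1 + H.toEuclideanLin p.1.2 +
          H.toEuclideanLin p.2‖ ^ 2) := by
    rw [add_assoc, linearEstimator_sub_eq, map_add, ← add_assoc, ENNReal.ofReal_pow (norm_nonneg _),
      ofReal_norm]
  unfold jitteringRisk
  simp_rw [herror]
  rw [← ofReal_integral_eq_lintegral_ofReal
      (by exact ((hcz.comp_fst _).add (hw.comp_snd _)).norm.integrable_sq)
      (ae_of_all _ fun _ => sq_nonneg _),
    integral_prod_norm_add_sq hcz hw (integral_toEuclideanLin_isoGaussian _ _), latentNoiseLaw,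
    integral_prod_norm_add_sq hc hz (integral_toEuclideanLin_isoGaussian _ _)]
  simp (disch := positivity) only [integral_norm_sq_toEuclideanLin_isoGaussian]
  ring_nf

-- Stationarity `ha` of `a` makes the cross terms of the two expansions cancel.
lemma frobenius_completing_square {U : Matrix (Fin n) (Fin d) ℝ} (hU : U.transpose * U = 1)
    {κ l a : ℝ} (ha : κ * (1 - a) = l * a) (H : Matrix (Fin n) (Fin n) ℝ) :
    κ * ‖(H - 1) * U‖ ^ 2 + l * ‖H‖ ^ 2 =
      κ * ‖(a • (U * U.transpose) - 1) * U‖ ^ 2 + l * ‖a • (U * U.transpose)‖ ^ 2 +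
      (κ * ‖(H - a • (U * U.transpose)) * U‖ ^ 2 + l * ‖H - a • (U * U.transpose)‖ ^ 2) := by
  obtain ⟨E, rfl⟩ : ∃ E, H = a • (U * U.transpose) + E := ⟨_, (add_sub_cancel _ H).symm⟩
  have hshrink : (a • (U * U.transpose) - 1) * U = (a - 1) • U := by
    simp only [Matrix.sub_mul, Matrix.smul_mul, Matrix.mul_assoc, hU, Matrix.mul_one,
      Matrix.one_mul, sub_smul, one_smul]
  rw [add_sub_cancel_left, add_sub_right_comm, Matrix.add_mul, hshrink, frobenius_norm_add_sq,
    frobenius_norm_add_sq]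
  simp only [Matrix.transpose_smul, Matrix.transpose_mul, Matrix.transpose_transpose,
    Matrix.mul_smul, Matrix.trace_smul, Matrix.mul_assoc, smul_eq_mul]
  linear_combination (-2 * (E * (U * U.transpose)).trace) * ha

lemma jitterShrinkage_stationary (hd : 0 < d) {σc : ℝ} (hc : 0 < σc) (n : ℕ) (σz σw : ℝ) :
    σc ^ 2 / d * (1 - jitterShrinkage d n σc σz σw) =
      (σz ^ 2 / n + σw ^ 2) * jitterShrinkage d n σc σz σw := by
  have hden : 0 < σc ^ 2 + σz ^ 2 * (d / n) + σw ^ 2 * d := by positivity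
  unfold jitterShrinkage
  rw [one_sub_div hden.ne']
  field_simp
  ring

lemma jitteringRisk_linearEstimator_eq_add (hd : 0 < d) {U : Matrix (Fin n) (Fin d) ℝ}
    (hU : U.transpose * U = 1) {σc : ℝ} (hc : 0 < σc) (σz σw : ℝ) {Hj : Matrix (Fin n) (Fin n) ℝ}
    (hHj : Hj = jitterShrinkage d n σc σz σw • (U * U.transpose))
    (H : Matrix (Fin n) (Fin n) ℝ) :
    jitteringRisk U σc σz σw (linearEstimator H) =
      jitteringRisk U σc σz σw (linearEstimator Hj) +
      ENNReal.ofReal (σc ^ 2 / d * ‖(H - Hj) * U‖ ^ 2 + (σz ^ 2 / n + σw ^ 2) * ‖H - Hj‖ ^ 2) := by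
  rw [jitteringRisk_linearEstimator, jitteringRisk_linearEstimator,
    ← ENNReal.ofReal_add (by positivity) (by positivity), hHj,
    frobenius_completing_square hU (jitterShrinkage_stationary hd hc n σz σw)]

lemma eq_of_jitteringRisk_linearEstimator_le (hd : 0 < d) {U : Matrix (Fin n) (Fin d) ℝ}
    (hU : U.transpose * U = 1) {σc σz : ℝ} (hc : 0 < σc) (hz : 0 < σz) (σw : ℝ)
    {H Hj : Matrix (Fin n) (Fin n) ℝ}
    (hHj : Hj = jitterShrinkage d n σc σz σw • (U * U.transpose))
    (hle : jitteringRisk U σc σz σw (linearEstimator H) ≤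
      jitteringRisk U σc σz σw (linearEstimator Hj)) : H = Hj := by
  rcases n.eq_zero_or_pos with rfl | hn
  · exact Subsingleton.elim _ _
  have hfin : jitteringRisk U σc σz σw (linearEstimator Hj) ≠ ∞ := by
    simp [jitteringRisk_linearEstimator]
  rw [jitteringRisk_linearEstimator_eq_add hd hU hc σz σw hHj H] at hle
  have hgap := ENNReal.ofReal_eq_zero.1 (nonpos_iff_eq_zero.1
    (ENNReal.le_of_add_le_add_left hfin (hle.trans_eq (add_zero _).symm)))
  have hweight : 0 < σz ^ 2 / n + σw ^ 2 := by positivity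
  have hlatent : 0 ≤ σc ^ 2 / d * ‖(H - Hj) * U‖ ^ 2 := by positivity
  have hnorm : ‖H - Hj‖ ^ 2 ≤ 0 := nonpos_of_mul_nonpos_right (by linarith) hweight
  simpa [sub_eq_zero] using hnorm

end JitteringRisk

section Shrinkage

/-- The limit `√(((α - 1) σ)² + (α τ)²) + |α| ε`, as `d → ∞` with `τ` fixed, of the root of the
robust risk of the shrinkage estimator `α U Uᵀ`, where `σ = σc` and `τ = σz √(d / n)` is the size of
the noise within the range of `U`. -/
noncomputable def limitingRobustError (σ τ ε α : ℝ) : ℝ :=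
  √(((α - 1) * σ) ^ 2 + (α * τ) ^ 2) + |α| * ε

variable {σ τ ε x y : ℝ}

lemma mul_le_limitingRobustError (hε : 0 ≤ ε) (hunit : x ^ 2 + y ^ 2 = 1)
    (hslope : σ * x - τ * y = ε) (α : ℝ) : σ * x ≤ limitingRobustError σ τ ε α := by
  have hcauchy : x * ((1 - α) * σ) + y * (α * τ) ≤ √(((α - 1) * σ) ^ 2 + (α * τ) ^ 2) := by
    refine Real.le_sqrt_of_sq_le ?_
    have hlagrange : ((α - 1) * σ) ^ 2 + (α * τ) ^ 2 - (x * ((1 - α) * σ) + y * (α * τ)) ^ 2 =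
        (x * (α * τ) - y * ((1 - α) * σ)) ^ 2 := by
      linear_combination (-(((α - 1) * σ) ^ 2 + (α * τ) ^ 2)) * hunit
    linarith [sq_nonneg (x * (α * τ) - y * ((1 - α) * σ))]
  calc σ * x = x * ((1 - α) * σ) + y * (α * τ) + α * ε := by linear_combination α * hslope
    _ ≤ limitingRobustError σ τ ε α := by
      unfold limitingRobustError
      gcongr
      exact le_abs_self α

lemma limitingRobustError_eq_mul (hσ : 0 ≤ σ) (hτ : 0 ≤ τ) (hy : 0 ≤ y)
    (hunit : x ^ 2 + y ^ 2 = 1) (hslope : σ * x - τ * y = ε) (hpos : 0 < τ * x + σ * y) :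
    limitingRobustError σ τ ε (σ * y / (τ * x + σ * y)) = σ * x := by
  obtain ⟨S, hS⟩ : ∃ S, τ * x + σ * y = S := ⟨_, rfl⟩
  rw [hS] at hpos ⊢
  have hcompl : σ * y / S - 1 = -(τ * x / S) := by
    field_simp
    linear_combination hS
  have hroot : √(((σ * y / S - 1) * σ) ^ 2 + (σ * y / S * τ) ^ 2) = σ * τ / S := by
    rw [hcompl, Real.sqrt_eq_iff_mul_self_eq (by positivity) (by positivity)]
    field_simp
    linear_combination σ ^ 2 * τ ^ 2 * hunit
  rw [limitingRobustError, hroot, abs_of_nonneg (by positivity)]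
  field_simp
  linear_combination σ * (x * hS - y * hslope - τ * hunit)

lemma limitingRobustError_le (hσ : 0 < σ) (hτ : 0 ≤ τ) (hε : 0 ≤ ε) (hεσ : ε ^ 2 < σ ^ 2) (α : ℝ) :
    limitingRobustError σ τ ε
        ((σ ^ 2 - ε * σ * τ / √(σ ^ 2 + τ ^ 2 - ε ^ 2)) / (σ ^ 2 + τ ^ 2)) ≤
      limitingRobustError σ τ ε α := by
  have hgap : 0 < σ ^ 2 + τ ^ 2 - ε ^ 2 := by linarith [sq_nonneg τ]
  have hsq := Real.sq_sqrt hgap.le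
  have hS := Real.sqrt_pos.2 hgap
  generalize √(σ ^ 2 + τ ^ 2 - ε ^ 2) = S at hsq hS ⊢
  have hN : 0 < σ ^ 2 + τ ^ 2 := by positivity
  -- `(x, y)` is the unit vector solving `σ x - τ y = ε` and `τ x + σ y = S`.
  obtain ⟨x, hx⟩ : ∃ x, x = (σ * ε + τ * S) / (σ ^ 2 + τ ^ 2) := ⟨_, rfl⟩
  obtain ⟨y, hy⟩ : ∃ y, y = (σ * S - ε * τ) / (σ ^ 2 + τ ^ 2) := ⟨_, rfl⟩
  have hunit : x ^ 2 + y ^ 2 = 1 := by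
    rw [hx, hy, div_pow, div_pow, ← add_div, div_eq_one_iff_eq (by positivity)]
    linear_combination (σ ^ 2 + τ ^ 2) * hsq
  have hslope : σ * x - τ * y = ε := by
    rw [hx, hy]
    field_simp
    ring
  have hsum : τ * x + σ * y = S := by
    rw [hx, hy]
    field_simp
    ring
  have hετ : ε * τ ≤ σ * S := by
    refine (abs_le_of_sq_le_sq' ?_ (by positivity)).2
    have hprod : 0 ≤ (σ ^ 2 - ε ^ 2) * (σ ^ 2 + τ ^ 2) := mul_nonneg (by linarith) hN.le
    linear_combination hprod - σ ^ 2 * hsq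
  have hy0 : 0 ≤ y := by
    rw [hy]
    exact div_nonneg (by linarith) hN.le
  have hfactor : (σ ^ 2 - ε * σ * τ / S) / (σ ^ 2 + τ ^ 2) = σ * y / (τ * x + σ * y) := by
    rw [hsum, hy]
    field_simp
  rw [hfactor, limitingRobustError_eq_mul hσ.le hτ hy0 hunit hslope (hsum ▸ hS)]
  exact mul_le_limitingRobustError hε hunit hslope α

variable {d n : ℕ} {σc σz : ℝ}

lemma limitingRobustError_robustShrinkage_le (hc : 0 < σc) (hz : 0 ≤ σz) (hε : 0 ≤ ε)
    (hεc : ε ^ 2 < σc ^ 2) (α : ℝ) :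
    limitingRobustError σc (σz * √(d / n)) ε (robustShrinkage d n σc σz ε) ≤
      limitingRobustError σc (σz * √(d / n)) ε α := by
  have hτ : (σz * √(d / n)) ^ 2 = σz ^ 2 * (d / n) := by
    rw [mul_pow, Real.sq_sqrt (by positivity)]
  have hle := limitingRobustError_le hc (τ := σz * √(d / n)) (by positivity) hε hεc α
  rwa [hτ, ← mul_assoc] at hle

lemma jitterShrinkage_eq_robustShrinkage (hd : 0 < d) (hc : 0 < σc) (hz : 0 ≤ σz) (hε : 0 ≤ ε)
    (hεc : ε ^ 2 < σc ^ 2) :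
    jitterShrinkage d n σc σz (jitterLevel d n σc σz ε) = robustShrinkage d n σc σz ε := by
  have hgap : 0 < σc ^ 2 - ε ^ 2 := by linarith
  unfold jitterShrinkage robustShrinkage jitterLevel
  rw [Real.sq_sqrt (by positivity), sub_add_eq_add_sub (σc ^ 2) (ε ^ 2)]
  have hr0 := Real.sqrt_nonneg ((d : ℝ) / n)
  have hr : √((d : ℝ) / n) ^ 2 = d / n := Real.sq_sqrt (by positivity)
  generalize √((d : ℝ) / n) = r at hr0 hr ⊢
  rw [← hr]
  have hrad : 0 < σc ^ 2 + σz ^ 2 * r ^ 2 - ε ^ 2 := by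
    linarith [mul_nonneg (sq_nonneg σz) (sq_nonneg r)]
  have hsq := Real.sq_sqrt hrad.le
  have hS := Real.sqrt_pos.2 hrad
  generalize √(σc ^ 2 + σz ^ 2 * r ^ 2 - ε ^ 2) = S at hsq hS ⊢
  have hden : σc ^ 2 + σz ^ 2 * r ^ 2 + (ε ^ 2 * σz ^ 2 * r ^ 2 + σz * r * σc * ε * S) /
      (d * (σc ^ 2 - ε ^ 2)) * d = σc * S * (σc * S + σz * r * ε) / (σc ^ 2 - ε ^ 2) := by
    field_simp
    linear_combination (-σc ^ 2) * hsq
  rw [hden, div_div_eq_mul_div, div_eq_div_iff (by positivity) (by positivity)]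
  field_simp
  linear_combination (-σc ^ 2) * hsq

end Shrinkage

section OrthogonalAveraging

lemma inv_card_smul_sum_mem_of_convex {κ E : Type*} [Fintype κ] [Nonempty κ] [AddCommGroup E]
    [Module ℝ E] {C : Set E} (hC : Convex ℝ C) {f : κ → E} (hf : ∀ k, f k ∈ C) :
    (Fintype.card κ : ℝ)⁻¹ • ∑ k, f k ∈ C := by
  rw [Finset.smul_sum]
  exact hC.sum_mem (fun _ _ => by positivity) (by simp) fun k _ => hf k

variable {ι : Type*} [Fintype ι] [DecidableEq ι]

lemma sum_intUnits_mul_eq_zero {i j : ι} (hij : i ≠ j) :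
    ∑ s : ι → ℤˣ, ((s i : ℤ) : ℝ) * ((s j : ℤ) : ℝ) = 0 := by
  have hflip := Equiv.sum_comp (Equiv.mulRight (Pi.mulSingle i (-1)))
    fun s : ι → ℤˣ => ((s i : ℤ) : ℝ) * ((s j : ℤ) : ℝ)
  simp only [Equiv.coe_mulRight, Pi.mul_apply, Pi.mulSingle_eq_same,
    Pi.mulSingle_eq_of_ne hij.symm, mul_one, Units.val_neg, Int.cast_neg, mul_neg, neg_mul,
    Finset.sum_neg_distrib] at hflip
  linarith

lemma sum_perm_apply_div_card (a : ι → ℝ) (i : ι) :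
    (Fintype.card (Equiv.Perm ι) : ℝ)⁻¹ * ∑ π : Equiv.Perm ι, a (π i) =
      (∑ j, a j) / Fintype.card ι := by
  have : Nonempty ι := ⟨i⟩
  have hconst (j : ι) : ∑ π : Equiv.Perm ι, a (π j) = ∑ π : Equiv.Perm ι, a (π i) := by
    simpa using Equiv.sum_comp (Equiv.mulRight (Equiv.swap i j)) fun π : Equiv.Perm ι => a (π i)
  have hdouble : ∑ j, ∑ π : Equiv.Perm ι, a (π j) = Fintype.card (Equiv.Perm ι) * ∑ j, a j := by
    rw [Finset.sum_comm]
    simp [Equiv.sum_comp]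
  simp only [hconst, Finset.sum_const, Finset.card_univ, nsmul_eq_mul] at hdouble
  rw [inv_mul_eq_div, div_eq_div_iff (by positivity) (by positivity)]
  linarith

variable {C : Set (Matrix ι ι ℝ)}

lemma diagonal_diag_mem_of_convex (hC : Convex ℝ C)
    (hconj : ∀ Q : Matrix ι ι ℝ, Q.transpose * Q = 1 → ∀ A ∈ C, Q.transpose * A * Q ∈ C)
    {A : Matrix ι ι ℝ} (hA : A ∈ C) : Matrix.diagonal A.diag ∈ C := by
  let D (s : ι → ℤˣ) : Matrix ι ι ℝ := Matrix.diagonal fun i => ((s i : ℤ) : ℝ)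
  have hsq (u : ℤˣ) : ((u : ℤ) : ℝ) * ((u : ℤ) : ℝ) = 1 := by
    rw [← Int.cast_mul, ← Units.val_mul, Int.units_mul_self, Units.val_one, Int.cast_one]
  have hmean := inv_card_smul_sum_mem_of_convex hC fun s : ι → ℤˣ =>
    hconj (D s) (by simp [D, hsq]) A hA
  convert hmean using 1
  ext i j
  simp only [D, Matrix.diagonal_transpose, Matrix.diagonal_mul, Matrix.mul_diagonal,
    Matrix.smul_apply, Matrix.sum_apply, smul_eq_mul]
  simp only [mul_right_comm _ (A i j), ← Finset.sum_mul]
  rcases eq_or_ne i j with rfl | hij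
  · simp [hsq]
  · simp [hij, sum_intUnits_mul_eq_zero hij]

lemma trace_div_card_smul_one_mem_of_convex (hC : Convex ℝ C)
    (hconj : ∀ Q : Matrix ι ι ℝ, Q.transpose * Q = 1 → ∀ A ∈ C, Q.transpose * A * Q ∈ C)
    {A : Matrix ι ι ℝ} (hA : A ∈ C) : (A.trace / Fintype.card ι) • (1 : Matrix ι ι ℝ) ∈ C := by
  have hpermute (π : Equiv.Perm ι) : Matrix.diagonal (A.diag ∘ π) ∈ C := by
    have horth : (Equiv.Perm.permMatrix ℝ π⁻¹).transpose * Equiv.Perm.permMatrix ℝ π⁻¹ = 1 := by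
      rw [Matrix.transpose_permMatrix, ← Matrix.permMatrix_mul]
      simp
    have hmem := hconj _ horth _ (diagonal_diag_mem_of_convex hC hconj hA)
    rwa [Matrix.transpose_permMatrix, inv_inv, Equiv.Perm.permMatrix, Equiv.Perm.permMatrix,
      PEquiv.toMatrix_toPEquiv_mul, PEquiv.mul_toMatrix_toPEquiv, Matrix.submatrix_submatrix,
      ← Equiv.Perm.inv_def, inv_inv, Function.comp_id, Function.id_comp,
      Matrix.submatrix_diagonal_equiv] at hmem
  convert inv_card_smul_sum_mem_of_convex hC hpermute using 1
  ext i j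
  rw [Matrix.smul_apply, Matrix.smul_apply, Matrix.sum_apply]
  rcases eq_or_ne i j with rfl | hij
  · simpa [Matrix.trace] using (sum_perm_apply_div_card A.diag i).symm
  · simp [hij]

end OrthogonalAveraging

section RobustRisk

variable {d n : ℕ} {U : Matrix (Fin n) (Fin d) ℝ} {σc σz ε : ℝ}

/-- The worst-case squared error `max_{‖e‖ ≤ ε} ‖f (U c + z + e) - U c‖²` at the sample
`p = (c, z)`, whose expectation is the robust risk. -/
noncomputable def worstCaseError (U : Matrix (Fin n) (Fin d) ℝ) (ε : ℝ)
    (f : EuclideanSpace ℝ (Fin n) → EuclideanSpace ℝ (Fin n))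
    (p : EuclideanSpace ℝ (Fin d) × EuclideanSpace ℝ (Fin n)) : ℝ≥0∞ :=
  ⨆ e ∈ Metric.closedBall (0 : EuclideanSpace ℝ (Fin n)) ε,
    ‖f (U.toEuclideanLin p.1 + p.2 + e) - U.toEuclideanLin p.1‖ₑ ^ 2

lemma robustRisk_eq_lintegral (U : Matrix (Fin n) (Fin d) ℝ) (σc σz ε : ℝ)
    (f : EuclideanSpace ℝ (Fin n) → EuclideanSpace ℝ (Fin n)) :
    robustRisk U σc σz ε f = ∫⁻ p, worstCaseError U ε f p ∂(latentNoiseLaw d n σc σz) := rfl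

lemma le_worstCaseError (U : Matrix (Fin n) (Fin d) ℝ)
    (f : EuclideanSpace ℝ (Fin n) → EuclideanSpace ℝ (Fin n))
    (p : EuclideanSpace ℝ (Fin d) × EuclideanSpace ℝ (Fin n)) {e : EuclideanSpace ℝ (Fin n)}
    (he : ‖e‖ ≤ ε) :
    ‖f (U.toEuclideanLin p.1 + p.2 + e) - U.toEuclideanLin p.1‖ₑ ^ 2 ≤ worstCaseError U ε f p :=
  le_iSup₂_of_le e (mem_closedBall_zero_iff.2 he) le_rfl

lemma worstCaseError_le {f : EuclideanSpace ℝ (Fin n) → EuclideanSpace ℝ (Fin n)}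
    {p : EuclideanSpace ℝ (Fin d) × EuclideanSpace ℝ (Fin n)} {r : ℝ≥0∞}
    (h : ∀ e, ‖e‖ ≤ ε →
      ‖f (U.toEuclideanLin p.1 + p.2 + e) - U.toEuclideanLin p.1‖ₑ ^ 2 ≤ r) :
    worstCaseError U ε f p ≤ r :=
  iSup₂_le fun e he => h e (mem_closedBall_zero_iff.1 he)

lemma measurable_worstCaseError_linearEstimator (U : Matrix (Fin n) (Fin d) ℝ) (ε : ℝ)
    (H : Matrix (Fin n) (Fin n) ℝ) : Measurable (worstCaseError U ε (linearEstimator H)) := by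
  have hU := U.toEuclideanLin.continuous_of_finiteDimensional
  have hH : Continuous (linearEstimator H) := H.toEuclideanLin.continuous_of_finiteDimensional
  exact (lowerSemicontinuous_biSup fun e _ =>
    Continuous.lowerSemicontinuous (by fun_prop)).measurable

lemma robustRisk_linearEstimator_conj_le {Q : Matrix (Fin d) (Fin d) ℝ}
    {S : Matrix (Fin n) (Fin n) ℝ} (hQ : Q.transpose * Q = 1) (hS : S.transpose * S = 1)
    (hSU : S * U = U * Q) (H : Matrix (Fin n) (Fin n) ℝ) :
    robustRisk U σc σz ε (linearEstimator (S.transpose * H * S)) ≤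
      robustRisk U σc σz ε (linearEstimator H) := by
  have hpres : MeasurePreserving (Prod.map (fun c => Q.toEuclideanLin c)
      (fun z => S.toEuclideanLin z)) (latentNoiseLaw d n σc σz) (latentNoiseLaw d n σc σz) :=
    (measurePreserving_toEuclideanLin_isoGaussian (by positivity) (mul_eq_one_comm.1 hQ)).prod
      (measurePreserving_toEuclideanLin_isoGaussian (by positivity) (mul_eq_one_comm.1 hS))
  rw [robustRisk_eq_lintegral, robustRisk_eq_lintegral,
    ← hpres.lintegral_comp (measurable_worstCaseError_linearEstimator U ε H)]
  refine lintegral_mono fun p => worstCaseError_le fun e he => ?_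
  have hintertwine : S.toEuclideanLin (U.toEuclideanLin p.1) =
      U.toEuclideanLin (Q.toEuclideanLin p.1) := by
    rw [← toEuclideanLin_mul_apply, hSU, toEuclideanLin_mul_apply]
  have hcancel : U.toEuclideanLin p.1 =
      S.transpose.toEuclideanLin (U.toEuclideanLin (Q.toEuclideanLin p.1)) := by
    rw [← hintertwine, ← toEuclideanLin_mul_apply, hS]
    simp
  have herror : linearEstimator (S.transpose * H * S) (U.toEuclideanLin p.1 + p.2 + e) -
      U.toEuclideanLin p.1 = S.transpose.toEuclideanLin
        (linearEstimator H (U.toEuclideanLin (Q.toEuclideanLin p.1) + S.toEuclideanLin p.2 +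
          S.toEuclideanLin e) - U.toEuclideanLin (Q.toEuclideanLin p.1)) := by
    rw [map_sub, ← hcancel, linearEstimator, linearEstimator, toEuclideanLin_mul_apply,
      toEuclideanLin_mul_apply, map_add S.toEuclideanLin, map_add S.toEuclideanLin, hintertwine]
  rw [herror, ← ofReal_norm, norm_toEuclideanLin_of_transpose_mul_self
    (by simpa using mul_eq_one_comm.1 hS), ofReal_norm]
  exact le_worstCaseError U (linearEstimator H) (Q.toEuclideanLin p.1, S.toEuclideanLin p.2)
    ((norm_toEuclideanLin_of_transpose_mul_self hS e).trans_le he)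

lemma norm_transpose_toEuclideanLin_le (hU : U.transpose * U = 1) (x : EuclideanSpace ℝ (Fin n)) :
    ‖U.transpose.toEuclideanLin x‖ ≤ ‖x‖ := by
  have hinner : ‖U.transpose.toEuclideanLin x‖ ^ 2 ≤ ‖U.transpose.toEuclideanLin x‖ * ‖x‖ :=
    calc ‖U.transpose.toEuclideanLin x‖ ^ 2
        = ⟪U.toEuclideanLin (U.transpose.toEuclideanLin x), x⟫ := by
          rw [inner_toEuclideanLin, real_inner_self_eq_norm_sq]
      _ ≤ ‖U.toEuclideanLin (U.transpose.toEuclideanLin x)‖ * ‖x‖ := real_inner_le_norm _ _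
      _ = ‖U.transpose.toEuclideanLin x‖ * ‖x‖ := by
          rw [norm_toEuclideanLin_of_transpose_mul_self hU]
  rw [sq] at hinner
  by_contra! hlt
  exact hinner.not_gt (mul_lt_mul_of_pos_left hlt ((norm_nonneg x).trans_lt hlt))

lemma robustRisk_linearEstimator_range_proj_mul_le (hU : U.transpose * U = 1)
    (H : Matrix (Fin n) (Fin n) ℝ) :
    robustRisk U σc σz ε (linearEstimator (U * U.transpose * H)) ≤
      robustRisk U σc σz ε (linearEstimator H) := by
  refine lintegral_mono fun p => worstCaseError_le (f := linearEstimator _) fun e he => ?_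
  refine le_trans ?_ (le_worstCaseError U (linearEstimator H) p he)
  have herror : linearEstimator (U * U.transpose * H) (U.toEuclideanLin p.1 + p.2 + e) -
      U.toEuclideanLin p.1 = U.toEuclideanLin (U.transpose.toEuclideanLin
        (linearEstimator H (U.toEuclideanLin p.1 + p.2 + e) - U.toEuclideanLin p.1)) := by
    rw [map_sub, ← toEuclideanLin_mul_apply U.transpose, hU, map_sub]
    simp [linearEstimator]
  gcongr
  rw [herror, enorm_le_iff_norm_le, norm_toEuclideanLin_of_transpose_mul_self hU]
  exact norm_transpose_toEuclideanLin_le hU _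

lemma enorm_convexCombination_sq_le {E : Type*} [NormedAddCommGroup E] [NormedSpace ℝ E] {a b : ℝ}
    (ha : 0 ≤ a) (hb : 0 ≤ b) (hab : a + b = 1) (x y : E) :
    ‖a • x + b • y‖ₑ ^ 2 ≤ ENNReal.ofReal a * ‖x‖ₑ ^ 2 + ENNReal.ofReal b * ‖y‖ₑ ^ 2 := by
  simp only [← ofReal_norm, ← ENNReal.ofReal_pow (norm_nonneg _), ← ENNReal.ofReal_mul ha,
    ← ENNReal.ofReal_mul hb]
  rw [← ENNReal.ofReal_add (by positivity) (by positivity)]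
  exact ENNReal.ofReal_le_ofReal
    ((convexOn_univ_norm.pow (fun _ _ => norm_nonneg _) 2).2 trivial trivial ha hb hab)

lemma worstCaseError_convexCombination_le {a b : ℝ} (ha : 0 ≤ a) (hb : 0 ≤ b) (hab : a + b = 1)
    (H K : Matrix (Fin n) (Fin n) ℝ) (p : EuclideanSpace ℝ (Fin d) × EuclideanSpace ℝ (Fin n)) :
    worstCaseError U ε (linearEstimator (a • H + b • K)) p ≤
      ENNReal.ofReal a * worstCaseError U ε (linearEstimator H) p +
        ENNReal.ofReal b * worstCaseError U ε (linearEstimator K) p := by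
  refine worstCaseError_le fun e he => ?_
  have herror (x y : EuclideanSpace ℝ (Fin n)) : linearEstimator (a • H + b • K) x - y =
      a • (linearEstimator H x - y) + b • (linearEstimator K x - y) := by
    simp only [linearEstimator, map_add, map_smul, LinearMap.add_apply, LinearMap.smul_apply,
      smul_sub, sub_add_sub_comm, ← add_smul, hab, one_smul]
  rw [herror]
  refine (enorm_convexCombination_sq_le ha hb hab _ _).trans ?_
  gcongr <;> exact le_worstCaseError U _ p he

lemma convex_robustRisk_linearEstimator_le (U : Matrix (Fin n) (Fin d) ℝ) (σc σz ε : ℝ)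
    (r : ℝ≥0∞) : Convex ℝ {H | robustRisk U σc σz ε (linearEstimator H) ≤ r} := by
  intro H hH K hK a b ha hb hab
  have hmeas := measurable_worstCaseError_linearEstimator U ε
  calc robustRisk U σc σz ε (linearEstimator (a • H + b • K))
      ≤ ENNReal.ofReal a * robustRisk U σc σz ε (linearEstimator H) +
          ENNReal.ofReal b * robustRisk U σc σz ε (linearEstimator K) := by
        simp only [robustRisk_eq_lintegral]
        rw [← lintegral_const_mul _ (hmeas H), ← lintegral_const_mul _ (hmeas K),
          ← lintegral_add_left ((hmeas H).const_mul _)]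
        exact lintegral_mono fun p => worstCaseError_convexCombination_le ha hb hab H K p
    _ ≤ ENNReal.ofReal a * r + ENNReal.ofReal b * r := by gcongr <;> assumption
    _ = r := by rw [← add_mul, ← ENNReal.ofReal_add ha hb, hab, ENNReal.ofReal_one, one_mul]

/-- The operator that acts on the range of `U` (whose columns are orthonormal) as `Q` acts on the
coordinates, and as multiplication by `s` on the orthogonal complement. -/
def rangeExtension (U : Matrix (Fin n) (Fin d) ℝ) (Q : Matrix (Fin d) (Fin d) ℝ) (s : ℝ) :
    Matrix (Fin n) (Fin n) ℝ :=
  U * Q * U.transpose + s • (1 - U * U.transpose)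

lemma rangeExtension_mul (hU : U.transpose * U = 1) (Q : Matrix (Fin d) (Fin d) ℝ) (s : ℝ) :
    rangeExtension U Q s * U = U * Q := by
  simp [rangeExtension, Matrix.add_mul, Matrix.sub_mul, Matrix.mul_assoc, hU]

lemma transpose_mul_rangeExtension (hU : U.transpose * U = 1) (Q : Matrix (Fin d) (Fin d) ℝ)
    (s : ℝ) : U.transpose * rangeExtension U Q s = Q * U.transpose := by
  simp [rangeExtension, Matrix.mul_add, Matrix.mul_sub, ← Matrix.mul_assoc, hU]

lemma transpose_rangeExtension_mul (hU : U.transpose * U = 1) (Q : Matrix (Fin d) (Fin d) ℝ)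
    (s : ℝ) : (rangeExtension U Q s).transpose * U = U * Q.transpose := by
  simpa using congrArg Matrix.transpose (transpose_mul_rangeExtension hU Q s)

lemma transpose_rangeExtension_mul_self (hU : U.transpose * U = 1) {Q : Matrix (Fin d) (Fin d) ℝ}
    (hQ : Q.transpose * Q = 1) {s : ℝ} (hs : s * s = 1) :
    (rangeExtension U Q s).transpose * rangeExtension U Q s = 1 := by
  have hcompl : (1 - U * U.transpose) * rangeExtension U Q s = s • (1 - U * U.transpose) := by
    rw [Matrix.sub_mul, Matrix.one_mul, Matrix.mul_assoc, transpose_mul_rangeExtension hU,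
      rangeExtension, Matrix.mul_assoc, add_sub_cancel_left]
  have htranspose : (rangeExtension U Q s).transpose =
      U * Q.transpose * U.transpose + s • (1 - U * U.transpose) := by
    simp [rangeExtension, Matrix.mul_assoc]
  rw [htranspose, Matrix.add_mul, Matrix.mul_assoc, transpose_mul_rangeExtension hU,
    Matrix.mul_assoc, ← Matrix.mul_assoc Q.transpose, hQ, Matrix.smul_mul, hcompl, smul_smul, hs]
  simp

lemma robustRisk_linearEstimator_compression_le (hU : U.transpose * U = 1)
    (H : Matrix (Fin n) (Fin n) ℝ) :
    robustRisk U σc σz ε (linearEstimator (U * (U.transpose * H * U) * U.transpose)) ≤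
      robustRisk U σc σz ε (linearEstimator H) := by
  set S := rangeExtension U 1 (-1) with hS
  have hSH : robustRisk U σc σz ε (linearEstimator (S.transpose * H * S)) ≤
      robustRisk U σc σz ε (linearEstimator H) :=
    robustRisk_linearEstimator_conj_le (by simp)
      (transpose_rangeExtension_mul_self hU (by simp) (by norm_num)) (rangeExtension_mul hU _ _) H
  have hmean := convex_robustRisk_linearEstimator_le U σc σz ε _ (Set.mem_ofPred.2 le_rfl) hSH
    (by norm_num : (0 : ℝ) ≤ 2⁻¹) (by norm_num : (0 : ℝ) ≤ 2⁻¹) (by norm_num)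
  have hproj : U * (U.transpose * H * U) * U.transpose =
      U * U.transpose * ((2⁻¹ : ℝ) • H + (2⁻¹ : ℝ) • (S.transpose * H * S)) := by
    have hUS : U.transpose * S.transpose = U.transpose := by
      rw [← Matrix.transpose_mul, hS, rangeExtension_mul hU, Matrix.mul_one]
    have hSval : S = (2 : ℝ) • (U * U.transpose) - 1 := by
      simp only [hS, rangeExtension, Matrix.mul_one, two_smul, neg_smul, one_smul]
      abel
    have hhalf : (2⁻¹ : ℝ) • (1 + S) = U * U.transpose := by
      rw [hSval]
      simp
    calc U * (U.transpose * H * U) * U.transpose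
        = U * (U.transpose * H * ((2⁻¹ : ℝ) • (1 + S))) := by
          rw [hhalf]
          simp only [Matrix.mul_assoc]
      _ = U * ((2⁻¹ : ℝ) • (U.transpose * H) +
            (2⁻¹ : ℝ) • (U.transpose * S.transpose * H * S)) := by
          simp only [hUS, Matrix.mul_smul, Matrix.mul_add, Matrix.mul_one, smul_add,
            Matrix.mul_assoc]
      _ = U * U.transpose * ((2⁻¹ : ℝ) • H + (2⁻¹ : ℝ) • (S.transpose * H * S)) := by
          simp only [Matrix.mul_smul, Matrix.mul_add, Matrix.mul_assoc]
  rw [hproj]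
  exact (robustRisk_linearEstimator_range_proj_mul_le hU _).trans hmean

lemma robustRisk_linearEstimator_mul_conj_le (hU : U.transpose * U = 1)
    {Q : Matrix (Fin d) (Fin d) ℝ} (hQ : Q.transpose * Q = 1) (A : Matrix (Fin d) (Fin d) ℝ) :
    robustRisk U σc σz ε (linearEstimator (U * (Q.transpose * A * Q) * U.transpose)) ≤
      robustRisk U σc σz ε (linearEstimator (U * A * U.transpose)) := by
  have hconj : U * (Q.transpose * A * Q) * U.transpose =
      (rangeExtension U Q 1).transpose * (U * A * U.transpose) * rangeExtension U Q 1 := by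
    rw [← Matrix.mul_assoc _ _ U.transpose, ← Matrix.mul_assoc _ U A,
      transpose_rangeExtension_mul hU, Matrix.mul_assoc _ U.transpose,
      transpose_mul_rangeExtension hU]
    simp only [Matrix.mul_assoc]
  rw [hconj]
  exact robustRisk_linearEstimator_conj_le hQ
    (transpose_rangeExtension_mul_self hU hQ (one_mul 1)) (rangeExtension_mul hU Q 1) _

lemma robustRisk_linearEstimator_trace_le (hU : U.transpose * U = 1)
    (H : Matrix (Fin n) (Fin n) ℝ) :
    robustRisk U σc σz ε
        (linearEstimator (((U.transpose * H * U).trace / d) • (U * U.transpose))) ≤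
      robustRisk U σc σz ε (linearEstimator H) := by
  have hconvex : Convex ℝ {A : Matrix (Fin d) (Fin d) ℝ | robustRisk U σc σz ε
      (linearEstimator (U * A * U.transpose)) ≤ robustRisk U σc σz ε (linearEstimator H)} :=
    (convex_robustRisk_linearEstimator_le U σc σz ε _).is_linear_preimage
      (f := fun A => U * A * U.transpose)
      { map_add := fun A B => by rw [Matrix.mul_add, Matrix.add_mul]
        map_smul := fun a A => by rw [Matrix.mul_smul, Matrix.smul_mul] }
  have hmem := Set.mem_ofPred.1 (trace_div_card_smul_one_mem_of_convex hconvex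
    (fun Q hQ A hA => (robustRisk_linearEstimator_mul_conj_le hU hQ A).trans hA)
    (robustRisk_linearEstimator_compression_le hU H))
  rwa [Fintype.card_fin, Matrix.mul_smul, Matrix.mul_one, Matrix.smul_mul] at hmem

lemma exists_norm_eq_one_and_eq_norm_smul {E : Type*} [NormedAddCommGroup E] [NormedSpace ℝ E]
    [Nontrivial E] (v : E) : ∃ u : E, ‖u‖ = 1 ∧ v = ‖v‖ • u := by
  rcases eq_or_ne v 0 with rfl | hv
  · obtain ⟨u, hu⟩ := exists_norm_eq E zero_le_one
    exact ⟨u, hu, by simp⟩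
  · exact ⟨‖v‖⁻¹ • v, norm_smul_inv_norm hv, (smul_inv_smul₀ (norm_ne_zero_iff.2 hv) v).symm⟩

lemma exists_norm_le_and_norm_add_smul_eq {E : Type*} [NormedAddCommGroup E] [NormedSpace ℝ E]
    [Nontrivial E] (hε : 0 ≤ ε) (α : ℝ) (v : E) :
    ∃ e : E, ‖e‖ ≤ ε ∧ ‖v + α • e‖ = ‖v‖ + |α| * ε := by
  obtain ⟨u, hu, hv⟩ := exists_norm_eq_one_and_eq_norm_smul v
  obtain ⟨s, hs, hsα⟩ : ∃ s : ℝ, |s| ≤ 1 ∧ α * s = |α| :=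
    ⟨SignType.sign α, by rcases lt_trichotomy α 0 with h | h | h <;> simp [h], self_mul_sign α⟩
  refine ⟨(s * ε) • u, ?_, ?_⟩
  · rw [norm_smul, hu, mul_one, norm_mul, Real.norm_eq_abs, Real.norm_of_nonneg hε]
    exact mul_le_of_le_one_left hε hs
  · have hray : v + α • (s * ε) • u = (‖v‖ + |α| * ε) • u := by
      rw [add_smul, ← hv, smul_smul, ← mul_assoc, hsα]
    rw [hray, norm_smul, hu, mul_one, Real.norm_of_nonneg (by positivity)]

lemma linearEstimator_smul_mul_transpose_sub (hU : U.transpose * U = 1) (α : ℝ)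
    (c : EuclideanSpace ℝ (Fin d)) (z e : EuclideanSpace ℝ (Fin n)) :
    linearEstimator (α • (U * U.transpose)) (U.toEuclideanLin c + z + e) - U.toEuclideanLin c =
      U.toEuclideanLin ((α - 1) • c + α • U.transpose.toEuclideanLin z +
        α • U.transpose.toEuclideanLin e) := by
  have hproj : U.transpose.toEuclideanLin (U.toEuclideanLin c) = c := by
    rw [← toEuclideanLin_mul_apply, hU]
    simp
  simp only [linearEstimator, map_smul, LinearMap.smul_apply, toEuclideanLin_mul_apply, map_add,
    hproj, sub_smul, one_smul, map_sub]
  abel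

lemma worstCaseError_smul_mul_transpose (hd : 0 < d) (hU : U.transpose * U = 1) (hε : 0 ≤ ε)
    (α : ℝ) (p : EuclideanSpace ℝ (Fin d) × EuclideanSpace ℝ (Fin n)) :
    worstCaseError U ε (linearEstimator (α • (U * U.transpose))) p =
      ENNReal.ofReal
        ((‖(α - 1) • p.1 + α • U.transpose.toEuclideanLin p.2‖ + |α| * ε) ^ 2) := by
  have herror (e : EuclideanSpace ℝ (Fin n)) :
      ‖linearEstimator (α • (U * U.transpose)) (U.toEuclideanLin p.1 + p.2 + e) -
          U.toEuclideanLin p.1‖ₑ ^ 2 =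
        ENNReal.ofReal (‖(α - 1) • p.1 + α • U.transpose.toEuclideanLin p.2 +
          α • U.transpose.toEuclideanLin e‖ ^ 2) := by
    rw [linearEstimator_smul_mul_transpose_sub hU, ← ofReal_norm,
      norm_toEuclideanLin_of_transpose_mul_self hU, ENNReal.ofReal_pow (norm_nonneg _)]
  generalize (α - 1) • p.1 + α • U.transpose.toEuclideanLin p.2 = v at herror ⊢
  refine le_antisymm (worstCaseError_le fun e he => ?_) ?_
  · rw [herror]
    gcongr
    refine (norm_add_le _ _).trans ?_
    rw [norm_smul, Real.norm_eq_abs]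
    gcongr
    exact (norm_transpose_toEuclideanLin_le hU e).trans he
  · have : Nonempty (Fin d) := ⟨⟨0, hd⟩⟩
    obtain ⟨e, he, hworst⟩ := exists_norm_le_and_norm_add_smul_eq hε α v
    refine le_trans (le_of_eq ?_) (le_worstCaseError U _ p
      ((norm_toEuclideanLin_of_transpose_mul_self hU e).trans_le he))
    rw [herror, ← toEuclideanLin_mul_apply, hU, Matrix.toLpLin_one, LinearMap.id_apply, hworst]

lemma robustRisk_smul_mul_transpose (hd : 0 < d) (hU : U.transpose * U = 1) (hε : 0 ≤ ε) (α : ℝ) :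
    robustRisk U σc σz ε (linearEstimator (α • (U * U.transpose))) =
      ENNReal.ofReal (∫ x, (‖x‖ + |α| * ε) ^ 2
        ∂(isoGaussian d ((α - 1) ^ 2 * (σc ^ 2 / d) + α ^ 2 * (σz ^ 2 / n)))) := by
  have hlaw := (measurePreserving_smul_add_smul_isoGaussian (k := d) (v := σc ^ 2 / d)
    (w := σz ^ 2 / n) (by positivity) (by positivity) (α - 1) α).comp
    ((MeasurePreserving.id _).prod (measurePreserving_toEuclideanLin_isoGaussian
      (v := σz ^ 2 / n) (M := U.transpose) (by positivity) (by simpa using hU)))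
  rw [ofReal_integral_eq_lintegral_ofReal (integrable_norm_add_const_sq_isoGaussian _ _ _)
    (ae_of_all _ fun _ => sq_nonneg _), ← hlaw.lintegral_comp (by fun_prop),
    robustRisk_eq_lintegral]
  exact lintegral_congr (worstCaseError_smul_mul_transpose hd hU hε α)

lemma limitingRobustError_eq_sqrt_add (hd : 0 < d) (n : ℕ) (σc σz ε α : ℝ) :
    limitingRobustError σc (σz * √(d / n)) ε α =
      √(((α - 1) ^ 2 * (σc ^ 2 / d) + α ^ 2 * (σz ^ 2 / n)) * d) + |α| * ε := by
  rw [limitingRobustError]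
  simp only [mul_pow]
  rw [Real.sq_sqrt (by positivity)]
  congr 2
  field_simp

lemma robustRisk_smul_mul_transpose_le (hd : 0 < d) (hU : U.transpose * U = 1) (hε : 0 ≤ ε)
    (α : ℝ) : robustRisk U σc σz ε (linearEstimator (α • (U * U.transpose))) ≤
      ENNReal.ofReal (limitingRobustError σc (σz * √(d / n)) ε α ^ 2) := by
  rw [robustRisk_smul_mul_transpose hd hU hε, limitingRobustError_eq_sqrt_add hd]
  exact ENNReal.ofReal_le_ofReal
    (integral_norm_add_const_sq_isoGaussian_le (by positivity) (by positivity))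

lemma le_robustRisk_smul_mul_transpose (hd : 0 < d) (hU : U.transpose * U = 1) (hε : 0 ≤ ε)
    (α : ℝ) :
    ENNReal.ofReal ((1 - 1 / d) * limitingRobustError σc (σz * √(d / n)) ε α ^ 2) ≤
      robustRisk U σc σz ε (linearEstimator (α • (U * U.transpose))) := by
  rw [robustRisk_smul_mul_transpose hd hU hε, limitingRobustError_eq_sqrt_add hd]
  exact ENNReal.ofReal_le_ofReal
    (le_integral_norm_add_const_sq_isoGaussian hd (by positivity) (by positivity))

lemma mul_robustRisk_robustShrinkage_le (hd : 0 < d) (hU : U.transpose * U = 1) (hc : 0 < σc)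
    (hz : 0 ≤ σz) (hε : 0 ≤ ε) (hεc : ε ^ 2 < σc ^ 2) (H : Matrix (Fin n) (Fin n) ℝ) :
    ENNReal.ofReal (1 - 1 / d) * robustRisk U σc σz ε
        (linearEstimator (robustShrinkage d n σc σz ε • (U * U.transpose))) ≤
      robustRisk U σc σz ε (linearEstimator H) := by
  have htrace := robustRisk_linearEstimator_trace_le (σc := σc) (σz := σz) (ε := ε) hU H
  generalize (U.transpose * H * U).trace / (d : ℝ) = α at htrace
  have hd1 : 0 ≤ 1 - 1 / (d : ℝ) := by
    rw [sub_nonneg, div_le_one (by positivity)]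
    exact_mod_cast hd
  have hopt := limitingRobustError_robustShrinkage_le (d := d) (n := n) hc hz hε hεc α
  have hnonneg : 0 ≤ limitingRobustError σc (σz * √(d / n)) ε (robustShrinkage d n σc σz ε) := by
    unfold limitingRobustError
    positivity
  calc _ ≤ ENNReal.ofReal (1 - 1 / d) * ENNReal.ofReal
          (limitingRobustError σc (σz * √(d / n)) ε (robustShrinkage d n σc σz ε) ^ 2) := by
        gcongr
        exact robustRisk_smul_mul_transpose_le hd hU hε _
    _ ≤ ENNReal.ofReal ((1 - 1 / d) * limitingRobustError σc (σz * √(d / n)) ε α ^ 2) := by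
        rw [← ENNReal.ofReal_mul hd1]
        gcongr
    _ ≤ robustRisk U σc σz ε (linearEstimator (α • (U * U.transpose))) :=
        le_robustRisk_smul_mul_transpose hd hU hε α
    _ ≤ robustRisk U σc σz ε (linearEstimator H) := htrace

end RobustRisk

lemma one_le_one_add_mul_one_sub_inv {δ : ℝ} (hδ : 0 < δ) {d : ℕ} (hD : ⌈(1 + δ) / δ⌉₊ ≤ d) :
    1 ≤ (1 + δ) * (1 - 1 / (d : ℝ)) := by
  have hdδ : 1 + δ ≤ d * δ := (div_le_iff₀ hδ).1 (Nat.ceil_le.1 hD)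
  have hpos : (0 : ℝ) < d := lt_of_lt_of_le (by positivity) (Nat.ceil_le.1 hD)
  field_simp
  linarith

end RobustDenoising

open RobustDenoising in
theorem corollary1_general (δ : ℝ) (hδ : 0 < δ) :
    ∃ D : ℕ, ∀ (d n : ℕ) (σc σz ε : ℝ) (U : Matrix (Fin n) (Fin d) ℝ),
      0 < d → U.transpose * U = 1 → 0 < σc → 0 ≤ σz → 0 ≤ ε → ε ^ 2 < σc ^ 2 →
      ∀ (σw : ℝ) (Hj : Matrix (Fin n) (Fin n) ℝ), σw = jitterLevel d n σc σz ε →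
      Hj = jitterShrinkage d n σc σz σw • (U * U.transpose) →
        (∀ H, jitteringRisk U σc σz σw (linearEstimator Hj) ≤
          jitteringRisk U σc σz σw (linearEstimator H)) ∧
        (0 < σz → ∀ H, jitteringRisk U σc σz σw (linearEstimator H) ≤
          jitteringRisk U σc σz σw (linearEstimator Hj) → H = Hj) ∧
        jitterShrinkage d n σc σz σw = robustShrinkage d n σc σz ε ∧
        (D ≤ d → ∀ H, robustRisk U σc σz ε (linearEstimator Hj) ≤
          ENNReal.ofReal (1 + δ) * robustRisk U σc σz ε (linearEstimator H)) := by
  refine ⟨⌈(1 + δ) / δ⌉₊, fun d n σc σz ε U hd hU hc hz hε hεc σw Hj hσw hHj => ?_⟩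
  have hshrink : jitterShrinkage d n σc σz σw = robustShrinkage d n σc σz ε :=
    hσw ▸ jitterShrinkage_eq_robustShrinkage hd hc hz hε hεc
  refine ⟨fun H => ?_, fun hz H => eq_of_jitteringRisk_linearEstimator_le hd hU hc hz σw hHj,
    hshrink, fun hD H => ?_⟩
  · rw [jitteringRisk_linearEstimator_eq_add hd hU hc σz σw hHj H]
    exact le_self_add
  · calc robustRisk U σc σz ε (linearEstimator Hj)
        ≤ ENNReal.ofReal ((1 + δ) * (1 - 1 / d)) * robustRisk U σc σz ε (linearEstimator Hj) :=
          le_mul_of_one_le_left' (ENNReal.one_le_ofReal.2 (one_le_one_add_mul_one_sub_inv hδ hD))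
      _ ≤ ENNReal.ofReal (1 + δ) * robustRisk U σc σz ε (linearEstimator H) := by
          rw [ENNReal.ofReal_mul (by positivity), mul_assoc, hHj, hshrink]
          gcongr
          exact mul_robustRisk_robustShrinkage_le hd hU hc hz hε hεc H

theorem corollary1 (δ : ℝ) (hδ : 0 < δ) :
    ∃ D : ℕ, ∀ (d n : ℕ) (σc σz ε : ℝ) (U : Matrix (Fin n) (Fin d) ℝ),
      0 < d → U.transpose * U = 1 → 0 < σc → 0 ≤ σz → 0 ≤ ε → ε ^ 2 < σc ^ 2 →
      ∀ (σw : ℝ) (Hj : Matrix (Fin n) (Fin n) ℝ),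
      σw = RobustDenoising.jitterLevel d n σc σz ε →
      Hj = RobustDenoising.jitterShrinkage d n σc σz σw • (U * U.transpose) →
        RobustDenoising.IsJitteringMinimizer U σc σz σw Hj ∧
        (0 < σz → ∀ H : Matrix (Fin n) (Fin n) ℝ,
          RobustDenoising.IsJitteringMinimizer U σc σz σw H → H = Hj) ∧
        RobustDenoising.jitterShrinkage d n σc σz σw =
          RobustDenoising.robustShrinkage d n σc σz ε ∧
        (D ≤ d → ∀ H : Matrix (Fin n) (Fin n) ℝ, H.IsSymm →
          RobustDenoising.robustRisk U σc σz ε (RobustDenoising.linearEstimator Hj) ≤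
            ENNReal.ofReal (1 + δ) *
              RobustDenoising.robustRisk U σc σz ε (RobustDenoising.linearEstimator H)) := by
  obtain ⟨D, hD⟩ := corollary1_general δ hδ
  refine ⟨D, fun d n σc σz ε U hd hU hc hz hε hεc σw Hj hσw hHj => ?_⟩
  obtain ⟨hmin, huniq, hshrink, hrobust⟩ := hD d n σc σz ε U hd hU hc hz hε hεc σw Hj hσw hHj
  have hsymm : Hj.IsSymm := by simp [hHj, Matrix.IsSymm]
  exact ⟨⟨hsymm, fun H _ => hmin H⟩, fun hz H hH => huniq hz H (hH.2 hsymm), hshrink,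
    fun hDd H _ => hrobust hDd H⟩
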